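/- A compact quantum group $G$ is given by its full Woronowicz $C^*$-algebra: a unital $C^*$-algebra $A_G$ with a dense $*$-subalgebra $\mathcal A_G$ that is a Hopf $*$-algebra (coproduct $\Delta$, counit $\epsilon$) spanned by the matrix coefficients of its finite-dimensional unitary corepresentations, where the norm of $A_G$ is the universal $C^*$-norm on $\mathcal A_G$. A quantum subgroup $(N,\pi)$ of $G$ is a compact quantum group $N$ with a surjective morphism $\pi\colon A_G\to A_N$ of Woronowicz $C^*$-algebras, i.e. a surjective unital $*$-homomorphism that restricts to a morphism of Hopf algebras $\hat\pi\colon\mathcal A_G\to\mathcal A_N$. It is normal if, with $h_N$ the Haar state of $N$, for every irreducible finite-dimensional unitary representation $u=(u_{ij})$ of $G$ the scalar matrix $(h_N\pi(u_{ij}))$ is either the identity matrix or $0$. Put $$\mathcal A_{G/N}=\{a\in\mathcal A_G : (\mathrm{id}\otimes\pi)\Delta(a)=a\otimes 1\},\qquad \mathcal A_{G/N}^+=\{a\in\mathcal A_{G/N}:\epsilon(a)=0\},$$ and let products of subspaces denote the linear span of the products of their elements. Let $(N,\pi)$ be a normal quantum subgroup of a compact quantum group $G$. Then $$\ker(\hat\pi)=\mathcal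 A_{G/N}^+\,\mathcal A_G=\mathcal A_G\,\mathcal A_{G/N}^+=\mathcal A_G\,\mathcal A_{G/N}^+\,\mathcal A_G .$$ Moreover the sequence of Hopf algebras $0\to\mathcal A_{G/N}\to\mathcal A_G\xrightarrow{\hat\pi}\mathcal A_N\to 0$ is exact, that is: $\mathcal A_{G/N}$ is a Hopf subalgebra of $\mathcal A_G$, $\hat\pi$ is surjective, $\ker(\hat\pi)=\mathcal A_G\,\mathcal A_{G/N}^+$, and $\mathcal A_{G/N}=\{a\in\mathcal A_G:(\hat\pi\otimes\mathrm{id})\Delta(a)=1\otimes a\}$. In particular $\mathcal A_N\cong\mathcal A_G/\mathcal A_G\mathcal A_{G/N}^+$ is recovered from $\mathcal A_{G/N}\subseteq\mathcal A_G$. -/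

import Mathlib

open scoped TensorProduct ComplexOrder

universe u v

namespace CQG

section HopfGeneralities

variable {H : Type*} [Ring H] [HopfAlgebra ℂ H]

/-- A matrix `u ∈ M_n(H)` with `Δ(u i j) = ∑ k, u i k ⊗ u k j` and `ε(u i j) = δ i j`:
a finite-dimensional corepresentation. -/
structure IsCorep {n : ℕ} (u : Matrix (Fin n) (Fin n) H) : Prop where
  comul_apply : ∀ i j, Coalgebra.comul (R := ℂ) (u i j) = ∑ k, u i k ⊗ₜ[ℂ] u k j
  counit_apply : ∀ i j, Coalgebra.counit (R := ℂ) (u i j) = if i = j then 1 else 0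

/-- A corepresentation on `ℂⁿ` is irreducible if `n ≠ 0` and no subspace of `ℂⁿ` other than `0` and
`ℂⁿ` is invariant. A subspace `W` is invariant when `u (w ⊗ 1) ∈ W ⊗ H` for all `w ∈ W`, that is,
when the scalar matrices `f(u)` preserve `W` for all linear functionals `f` on `H`. -/
structure IsIrreducibleCorep {n : ℕ} (u : Matrix (Fin n) (Fin n) H) : Prop extends IsCorep u where
  ne_zero : n ≠ 0
  eq_bot_or_eq_top : ∀ W : Submodule ℂ (Fin n → ℂ),
    (∀ f : H →ₗ[ℂ] ℂ, ∀ w ∈ W, (u.map f).mulVec w ∈ W) → W = ⊥ ∨ W = ⊤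

/-- `K⁺`, the elements of the subalgebra `K` that are killed by the counit (which, when `K` is
a Hopf subalgebra, restricts to the counit of `K`). -/
def augmentation (K : Subalgebra ℂ H) : Submodule ℂ H :=
  Subalgebra.toSubmodule K ⊓ LinearMap.ker (Coalgebra.counit (R := ℂ) (A := H))

/-- Exactness of `0 → K → H → L → 0` for a subalgebra `K` of a Hopf algebra `H` and a morphism
`p : H → L` of Hopf algebras: `K` is a Hopf subalgebra of `H`, `p` is surjective,
`ker p = H K⁺`, and `K` is the algebra of coinvariants `{a | (p ⊗ id) Δ a = 1 ⊗ a}`. -/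
structure IsExactSequence {L : Type*} [Ring L] [HopfAlgebra ℂ L]
    (K : Subalgebra ℂ H) (p : H →ₐc[ℂ] L) : Prop where
  comul_mem : ∀ a ∈ K, Coalgebra.comul (R := ℂ) a ∈
    LinearMap.range (TensorProduct.map K.val.toLinearMap K.val.toLinearMap)
  antipode_mem : ∀ a ∈ K, HopfAlgebra.antipode ℂ a ∈ K
  surjective : Function.Surjective p
  ker_eq : LinearMap.ker (p : H →ₗ[ℂ] L) = (⊤ : Submodule ℂ H) * augmentation K
  mem_iff : ∀ a : H, a ∈ K ↔
    TensorProduct.map (p : H →ₗ[ℂ] L) LinearMap.id (Coalgebra.comul (R := ℂ) a) =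
      (1 : L) ⊗ₜ[ℂ] a

end HopfGeneralities

/-- A compact quantum group `G`, given by its full Woronowicz `C*`-algebra: a unital `C*`-algebra
`C = A_G` containing, as a dense `*`-subalgebra (through `ι`), a Hopf `*`-algebra `Pol = 𝒜_G` that is
spanned by the matrix coefficients of its finite-dimensional unitary corepresentations, such that
the norm of `C` is the universal `C*`-norm on `Pol`. -/
structure CompactQuantumGroup where
  C : Type u
  Pol : Type u
  [cstar : CStarAlgebra C]
  [ring : Ring Pol]
  [starRing : StarRing Pol]
  [hopf : HopfAlgebra ℂ Pol]
  [starModule : StarModule ℂ Pol]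
  /-- `Δ(a*) = Δ(a)^{* ⊗ *}` -/
  comul_star : ∀ a : Pol, Coalgebra.comul (R := ℂ) (star a) = star (Coalgebra.comul (R := ℂ) a)
  span_coeff : Submodule.span ℂ {a : Pol | ∃ (n : ℕ) (u : Matrix (Fin n) (Fin n) Pol),
    IsCorep u ∧ u ∈ unitary (Matrix (Fin n) (Fin n) Pol) ∧ ∃ i j, a = u i j} = ⊤
  ι : Pol →⋆ₐ[ℂ] C
  ι_injective : Function.Injective ι
  ι_denseRange : DenseRange ι
  /-- Fullness: every `C*`-seminorm on `Pol` is dominated by the norm of `C`. -/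
  full : ∀ p : Seminorm ℂ Pol, (∀ a b, p (a * b) ≤ p a * p b) →
    (∀ a, p (star a * a) = p a ^ 2) → ∀ a, p a ≤ ‖ι a‖

attribute [instance] CompactQuantumGroup.cstar CompactQuantumGroup.ring
  CompactQuantumGroup.starRing CompactQuantumGroup.hopf CompactQuantumGroup.starModule

/-- `h` is the Haar state of `N`: a state on `A_N` with
`(id ⊗ h) Δ a = h(a) 1 = (h ⊗ id) Δ a` for `a` in the dense Hopf `*`-algebra `𝒜_N`. -/
structure IsHaarState (N : CompactQuantumGroup.{u}) (h : N.C →L[ℂ] ℂ) : Prop where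
  map_one : h 1 = 1
  nonneg : ∀ a : N.C, 0 ≤ h (star a * a)
  left_invariant : ∀ a : N.Pol,
    TensorProduct.rid ℂ N.Pol (LinearMap.lTensor N.Pol
      (h.toLinearMap ∘ₗ N.ι.toAlgHom.toLinearMap) (Coalgebra.comul (R := ℂ) a)) =
      h (N.ι a) • (1 : N.Pol)
  right_invariant : ∀ a : N.Pol,
    TensorProduct.lid ℂ N.Pol (LinearMap.rTensor N.Pol
      (h.toLinearMap ∘ₗ N.ι.toAlgHom.toLinearMap) (Coalgebra.comul (R := ℂ) a)) =
      h (N.ι a) • (1 : N.Pol)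

/-- A quantum subgroup `(N, π)` of `G`: a surjective morphism `π : A_G → A_N` of Woronowicz
`C*`-algebras, together with the morphism `hat = π̂ : 𝒜_G → 𝒜_N` of Hopf algebras to which it
restricts (`hat` is determined by `π`, since `N.ι` is injective). -/
structure QuantumSubgroup (G : CompactQuantumGroup.{u}) (N : CompactQuantumGroup.{v}) where
  π : G.C →⋆ₐ[ℂ] N.C
  surjective : Function.Surjective π
  hat : G.Pol →ₐc[ℂ] N.Pol
  ι_hat : ∀ a : G.Pol, N.ι (hat a) = π (G.ι a)

namespace QuantumSubgroup

variable {G : CompactQuantumGroup.{u}} {N : CompactQuantumGroup.{v}} (P : QuantumSubgroup G N)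

/-- `𝒜_{G/N} = {a ∈ 𝒜_G | (id ⊗ π) Δ a = a ⊗ 1}`. -/
noncomputable def quotient : Subalgebra ℂ G.Pol :=
  AlgHom.equalizer
    ((Algebra.TensorProduct.map (AlgHom.id ℂ G.Pol) (P.hat : G.Pol →ₐ[ℂ] N.Pol)).comp
      (Bialgebra.comulAlgHom ℂ G.Pol))
    (Algebra.TensorProduct.includeLeft : G.Pol →ₐ[ℂ] G.Pol ⊗[ℂ] N.Pol)

/-- `(N, π)` is normal: with `h` the Haar state of `N`, for every irreducible unitary
representation `v` of `G` the scalar matrix `h π(v)` is the identity or zero. -/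
def IsNormal : Prop :=
  ∃ h : N.C →L[ℂ] ℂ, IsHaarState N h ∧
    ∀ (n : ℕ) (v : Matrix (Fin n) (Fin n) G.Pol),
      IsIrreducibleCorep v → v ∈ unitary (Matrix (Fin n) (Fin n) G.Pol) →
        (v.map fun a => h (P.π (G.ι a))) = 1 ∨ (v.map fun a => h (P.π (G.ι a))) = 0

end QuantumSubgroup

end CQG

/-! Write `φ = h ∘ π̂`. Invariance of the Haar state makes `E = (id ⊗ φ)Δ` a projection of `𝒜_G`
onto `𝒜_{G/N}`, with `π̂(E a) = φ(a) 1`. Everything rests on the identity `S(a₁) E(a₂ x) = (id ⊗ φ(a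
·))Δ(x)` (`IsCorep.sum_antipode_mul_rightSlice`). If `π̂ x = 0`, each `E(bx)` lies in `𝒜_{G/N}⁺`, so
all slices `(id ⊗ φ(y ·))Δ(x)` lie in `𝒜_G 𝒜_{G/N}⁺`. A functional `f` vanishing on that space then
satisfies `φ(y · (f ⊗ id)Δ(x)) = 0` for all `y`; nondegeneracy of `h` gives `π̂((f ⊗ id)Δ(x)) = 0`,
and the counit gives `f(x) = 0`. Thus `x` lies in `𝒜_G 𝒜_{G/N}⁺` (`ker_hat_le`).

The same identity yields nondegeneracy of `h` (`eq_zero_of_forall_apply_mul_eq_zero`) and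
surjectivity of `π̂` (`hat_surjective`). The other ideal descriptions follow from the involution.

Normality serves only the Hopf subalgebra and coinvariant claims: on coefficients of an irreducible,
`(id ⊗ φ)Δ` and `(φ ⊗ id)Δ` multiply by the same scalar `0` or `1`. Hence left and right
coinvariants agree and `𝒜_{G/N}` is spanned by coefficients of irreducibles. This needs complete
reducibility of unitary corepresentations. -/

namespace CQG

/-! ### Slice maps and nondegeneracy of invariant functionals -/

section Slices

variable {H : Type*} [Ring H] [HopfAlgebra ℂ H]

/-- The map `a ↦ (id ⊗ φ) Δ a`. -/
noncomputable def rightSlice (φ : H →ₗ[ℂ] ℂ) : H →ₗ[ℂ] H :=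
  (TensorProduct.rid ℂ H).toLinearMap ∘ₗ LinearMap.lTensor H φ ∘ₗ Coalgebra.comul

/-- The map `a ↦ (φ ⊗ id) Δ a`. -/
noncomputable def leftSlice (φ : H →ₗ[ℂ] ℂ) : H →ₗ[ℂ] H :=
  (TensorProduct.lid ℂ H).toLinearMap ∘ₗ LinearMap.rTensor H φ ∘ₗ Coalgebra.comul

lemma rightSlice_apply (φ : H →ₗ[ℂ] ℂ) (a : H) :
    rightSlice φ a =
      TensorProduct.rid ℂ H (LinearMap.lTensor H φ (Coalgebra.comul (R := ℂ) a)) := rfl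

lemma leftSlice_apply (φ : H →ₗ[ℂ] ℂ) (a : H) :
    leftSlice φ a =
      TensorProduct.lid ℂ H (LinearMap.rTensor H φ (Coalgebra.comul (R := ℂ) a)) := rfl

/-- Both sides are `(f ⊗ φ)Δ(x)`. This turns membership of right slices in `ker f` into vanishing of
`φ` on a left slice. -/
lemma apply_rightSlice (f φ : H →ₗ[ℂ] ℂ) (x : H) :
    f (rightSlice φ x) = φ (leftSlice f x) := by
  rw [rightSlice_apply, leftSlice_apply]
  induction Coalgebra.comul (R := ℂ) x using TensorProduct.induction_on with
  | zero => simp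
  | tmul a b => simp [mul_comm]
  | add a b ha hb => simp only [map_add, ha, hb]

lemma counit_leftSlice (f : H →ₗ[ℂ] ℂ) (x : H) :
    Coalgebra.counit (R := ℂ) (leftSlice f x) = f x := by
  rw [← apply_rightSlice, rightSlice_apply, Coalgebra.lTensor_counit_comul]
  simp

/-- A subspace contains `x` if `ε((f ⊗ id) Δ x) = 0` for all functionals `f` vanishing on it. -/
lemma mem_of_forall_leftSlice {K : Submodule ℂ H} {x : H}
    (hK : ∀ f : H →ₗ[ℂ] ℂ, K ≤ LinearMap.ker f →
      Coalgebra.counit (R := ℂ) (leftSlice f x) = 0) : x ∈ K := by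
  by_contra hx
  obtain ⟨f, hfx, hf⟩ := Submodule.exists_le_ker_of_notMem hx
  exact hfx (by rw [← counit_leftSlice, hK f hf])

lemma rid_lTensor_tmul_mul (φ : H →ₗ[ℂ] ℂ) (a b : H) (t : H ⊗[ℂ] H) :
    TensorProduct.rid ℂ H (LinearMap.lTensor H φ ((a ⊗ₜ[ℂ] b) * t)) =
      a * TensorProduct.rid ℂ H (LinearMap.lTensor H (φ ∘ₗ LinearMap.mulLeft ℂ b) t) := by
  induction t using TensorProduct.induction_on with
  | zero => simp
  | tmul c d => simp
  | add c d hc hd => simp only [mul_add, map_add, hc, hd]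

lemma IsCorep.sum_antipode_mul {n : ℕ} {w : Matrix (Fin n) (Fin n) H} (hw : IsCorep w)
    (i j : Fin n) :
    ∑ k, HopfAlgebra.antipode ℂ (w i k) * w k j = if i = j then 1 else 0 := by
  have h := HopfAlgebra.mul_antipode_rTensor_comul_apply (R := ℂ) (w i j)
  rw [hw.comul_apply, hw.counit_apply] at h
  simpa [apply_ite] using h

lemma IsCorep.sum_mul_antipode {n : ℕ} {w : Matrix (Fin n) (Fin n) H} (hw : IsCorep w)
    (i j : Fin n) :
    ∑ k, w i k * HopfAlgebra.antipode ℂ (w k j) = if i = j then 1 else 0 := by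
  have h := HopfAlgebra.mul_antipode_lTensor_comul_apply (R := ℂ) (w i j)
  rw [hw.comul_apply, hw.counit_apply] at h
  simpa [apply_ite] using h

lemma IsCorep.mul_map_antipode {n : ℕ} {w : Matrix (Fin n) (Fin n) H} (hw : IsCorep w) :
    w * w.map (HopfAlgebra.antipode ℂ) = 1 := by
  ext i j
  simp [Matrix.mul_apply, hw.sum_mul_antipode, Matrix.one_apply]

lemma IsCorep.rightSlice_apply {n : ℕ} {w : Matrix (Fin n) (Fin n) H} (hw : IsCorep w)
    (φ : H →ₗ[ℂ] ℂ) (i j : Fin n) : rightSlice φ (w i j) = ∑ k, φ (w k j) • w i k := by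
  simp [CQG.rightSlice_apply, hw.comul_apply]

lemma IsCorep.leftSlice_apply {n : ℕ} {w : Matrix (Fin n) (Fin n) H} (hw : IsCorep w)
    (φ : H →ₗ[ℂ] ℂ) (i j : Fin n) : leftSlice φ (w i j) = ∑ k, φ (w i k) • w k j := by
  simp [CQG.leftSlice_apply, hw.comul_apply]

/-- `S(a₁) (id ⊗ φ) Δ(a₂ x) = (id ⊗ φ(a ·)) Δ(x)` for matrix coefficients `a`. -/
lemma IsCorep.sum_antipode_mul_rightSlice {n : ℕ} {w : Matrix (Fin n) (Fin n) H}
    (hw : IsCorep w) (φ : H →ₗ[ℂ] ℂ) (i j : Fin n) (x : H) :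
    ∑ m, HopfAlgebra.antipode ℂ (w i m) * rightSlice φ (w m j * x) =
      rightSlice (φ ∘ₗ LinearMap.mulLeft ℂ (w i j)) x := by
  simp only [CQG.rightSlice_apply, Bialgebra.comul_mul, hw.comul_apply, Finset.sum_mul, map_sum,
    rid_lTensor_tmul_mul, Finset.mul_sum, ← mul_assoc]
  -- Summing over `m` first, `∑ S(w i m) w m k` collapses to `δ i k` by the antipode axiom.
  rw [Finset.sum_comm]
  simp only [← Finset.sum_mul, hw.sum_antipode_mul]
  simp

/-- `H` is spanned by the matrix coefficients of its corepresentations. -/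
def IsSpannedByCoeffs (H : Type*) [Ring H] [HopfAlgebra ℂ H] : Prop :=
  Submodule.span ℂ {a : H | ∃ (n : ℕ) (w : Matrix (Fin n) (Fin n) H),
    IsCorep w ∧ ∃ i j, a = w i j} = ⊤

/-- The map `y ↦ (id ⊗ φ(y ·)) Δ x`. -/
noncomputable def rightSliceMul (φ : H →ₗ[ℂ] ℂ) (x : H) : H →ₗ[ℂ] H :=
  (TensorProduct.rid ℂ H).toLinearMap ∘ₗ
    (LinearMap.lTensorHom H ∘ₗ LinearMap.llcomp ℂ H H ℂ φ ∘ₗ LinearMap.mul ℂ H).flip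
      (Coalgebra.comul (R := ℂ) x)

/-- The slice is linear in `y`, so `y` may be a matrix coefficient, where the antipode identity
writes it as a sum of terms `a * rightSlice φ (b * x)`. Used with `K = 0` for nondegeneracy and `K =
𝒜_G 𝒜_{G/N}⁺` for the kernel. -/
lemma rightSlice_comp_mulLeft_mem (hH : IsSpannedByCoeffs H) {K : Submodule ℂ H}
    {φ : H →ₗ[ℂ] ℂ} {x : H}
    (hK : ∀ a b, a * rightSlice φ (b * x) ∈ K) (y : H) :
    rightSlice (φ ∘ₗ LinearMap.mulLeft ℂ y) x ∈ K := by
  suffices ⊤ ≤ K.comap (rightSliceMul φ x) from this (Submodule.mem_top (x := y))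
  rw [← hH, Submodule.span_le]
  rintro _ ⟨n, w, hw, i, j, rfl⟩
  change rightSlice (φ ∘ₗ LinearMap.mulLeft ℂ (w i j)) x ∈ K
  rw [← hw.sum_antipode_mul_rightSlice]
  exact Submodule.sum_mem _ fun m _ => hK _ _

/-- An invariant functional `φ` with `φ 1 ≠ 0` induces a nondegenerate pairing. -/
lemma eq_zero_of_forall_apply_mul_eq_zero (hH : IsSpannedByCoeffs H) {φ : H →ₗ[ℂ] ℂ}
    (hφ1 : φ 1 ≠ 0) (hφ : ∀ a, rightSlice φ a = φ a • (1 : H)) {x : H}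
    (hx : ∀ y, φ (y * x) = 0) : x = 0 := by
  -- The radical of the pairing is stable under left slices.
  have h1 : ∀ x : H, (∀ y, φ (y * x) = 0) → ∀ (f : H →ₗ[ℂ] ℂ) (y : H),
      φ (y * leftSlice f x) = 0 := by
    intro x hx f y
    have := rightSlice_comp_mulLeft_mem hH (K := ⊥) (φ := φ) (x := x)
      (fun a b => by simp [hφ, hx]) y
    have h2 := apply_rightSlice f (φ ∘ₗ LinearMap.mulLeft ℂ y) x
    rw [(Submodule.mem_bot ℂ).1 this, map_zero] at h2
    simpa using h2.symm
  -- Apply `φ` to `S(x₁) x₂ = ε(x) 1`: expanding `Δ x` in a basis of the left leg makes the right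
  -- legs left slices of `x`, so the left side dies by `h1`, while `φ 1 ≠ 0`.
  have h2 : ∀ x : H, (∀ y, φ (y * x) = 0) → Coalgebra.counit (R := ℂ) x = 0 := by
    intro x hx
    classical
    let b := Module.Basis.ofVectorSpace ℂ H
    obtain ⟨c, hc⟩ := TensorProduct.eq_repr_basis_left b (Coalgebra.comul (R := ℂ) x)
    have hci : ∀ i, c i = leftSlice (b.coord i) x := by
      intro i
      rw [leftSlice_apply, ← TensorProduct.equivFinsuppOfBasisLeft_apply, ← hc,
        ← TensorProduct.equivFinsuppOfBasisLeft_symm_apply, LinearEquiv.apply_symm_apply]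
    have h3 := congrArg φ (HopfAlgebra.mul_antipode_rTensor_comul_apply (R := ℂ) x)
    rw [← hc, Finsupp.sum, map_sum, map_sum, map_sum, Finset.sum_eq_zero,
      Algebra.algebraMap_eq_smul_one, map_smul] at h3
    · simpa [hφ1] using h3.symm
    · intro i _
      simpa [hci] using h1 x hx (b.coord i) _
  rw [← Module.forall_dual_apply_eq_zero_iff ℂ]
  intro f
  rw [← counit_leftSlice]
  exact h2 _ (h1 x hx f)

end Slices

/-! ### Complete reducibility of unitary corepresentations -/

section Irreducible

variable {H : Type*} [Ring H] [HopfAlgebra ℂ H]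

section Compress

variable {n k : ℕ} {w : Matrix (Fin n) (Fin n) H} {M : Matrix (Fin n) (Fin k) ℂ}
  {v : Matrix (Fin k) (Fin k) H}

/-- The hypothesis `hv` is the intertwining relation `w M = M v`; since `M` is an isometry, `v = M*
w M`. -/
lemma compress_apply (hM : M.conjTranspose * M = 1)
    (hv : ∀ a j, ∑ b, M b j • w a b = ∑ l, M a l • v l j) (i j : Fin k) :
    v i j = ∑ a, star (M a i) • ∑ b, M b j • w a b := by
  simp only [hv, Finset.smul_sum, smul_smul]
  rw [Finset.sum_comm]
  simp only [← Finset.sum_smul]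
  have : ∀ l, ∑ a, star (M a i) * M a l = if i = l then 1 else 0 := fun l => by
    have := congrFun (congrFun hM i) l
    simpa [Matrix.mul_apply, Matrix.one_apply] using this
  simp only [this, ite_smul, one_smul, zero_smul, Finset.sum_ite_eq, Finset.mem_univ, if_true]

lemma IsCorep.compress (hw : IsCorep w) (hM : M.conjTranspose * M = 1)
    (hv : ∀ a j, ∑ b, M b j • w a b = ∑ l, M a l • v l j) : IsCorep v where
  comul_apply i j := by
    have h1 : ∀ a, Coalgebra.comul (R := ℂ) (∑ b, M b j • w a b) =
        ∑ l, (∑ m, M m l • w a m) ⊗ₜ[ℂ] v l j := by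
      intro a
      calc Coalgebra.comul (R := ℂ) (∑ b, M b j • w a b)
          = ∑ m, w a m ⊗ₜ[ℂ] ∑ b, M b j • w m b := by
            simp only [map_sum, map_smul, hw.comul_apply, Finset.smul_sum,
              TensorProduct.tmul_sum, TensorProduct.tmul_smul]
            rw [Finset.sum_comm]
        _ = _ := by
            simp only [hv _ j, TensorProduct.tmul_sum, TensorProduct.tmul_smul,
              TensorProduct.sum_tmul, TensorProduct.smul_tmul']
            rw [Finset.sum_comm]
    rw [compress_apply hM hv i j, map_sum]
    simp only [map_smul, h1]
    simp only [compress_apply hM hv i, Finset.smul_sum, TensorProduct.sum_tmul,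
      TensorProduct.smul_tmul']
    rw [Finset.sum_comm]
  counit_apply i j := by
    rw [compress_apply hM hv i j]
    simp only [map_sum, map_smul, hw.counit_apply]
    have := congrFun (congrFun hM i) j
    simpa [Matrix.mul_apply, Matrix.one_apply] using this

end Compress

variable [StarRing H]

/-- Over a noncommutative ring a left inverse need not be a right inverse, but `S(w)` is a right
inverse of `w`, so `star w` must equal it. -/
lemma IsCorep.mem_unitary {n : ℕ} {w : Matrix (Fin n) (Fin n) H} (hw : IsCorep w)
    (h : star w * w = 1) : w ∈ unitary (Matrix (Fin n) (Fin n) H) := by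
  refine Unitary.mem_iff.2 ⟨h, ?_⟩
  have : star w = w.map (HopfAlgebra.antipode ℂ) := by
    rw [← mul_one (star w), ← hw.mul_map_antipode, ← mul_assoc, h, one_mul]
  rw [this, hw.mul_map_antipode]

lemma IsCorep.antipode_apply {n : ℕ} {w : Matrix (Fin n) (Fin n) H} (hw : IsCorep w)
    (h : w ∈ unitary (Matrix (Fin n) (Fin n) H)) (i j : Fin n) :
    HopfAlgebra.antipode ℂ (w i j) = star (w j i) := by
  have : star w = w.map (HopfAlgebra.antipode ℂ) := by
    rw [← mul_one (star w), ← hw.mul_map_antipode, ← mul_assoc, (Unitary.mem_iff.1 h).1, one_mul]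
  exact (congrFun (congrFun this i) j).symm

variable [StarModule ℂ H]

lemma IsCorep.compress_mem_unitary {n k : ℕ} {w : Matrix (Fin n) (Fin n) H}
    {M : Matrix (Fin n) (Fin k) ℂ} {v : Matrix (Fin k) (Fin k) H} (hw : IsCorep w)
    (hu : w ∈ unitary (Matrix (Fin n) (Fin n) H)) (hM : M.conjTranspose * M = 1)
    (hv : ∀ a j, ∑ b, M b j • w a b = ∑ l, M a l • v l j) :
    v ∈ unitary (Matrix (Fin k) (Fin k) H) := by
  refine (hw.compress hM hv).mem_unitary ?_
  set X : Matrix (Fin n) (Fin k) H := M.map (algebraMap ℂ H) with hX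
  have hXX : X.conjTranspose * X = 1 := by
    have : X.conjTranspose = M.conjTranspose.map (algebraMap ℂ H) := by
      ext i j
      exact (algebraMap_star_comm _).symm
    rw [this, hX, ← Matrix.map_mul, hM]
    simp
  have hwX : w * X = X * v := by
    ext a j
    have h := hv a j
    simp only [Algebra.smul_def] at h
    simp only [Matrix.mul_apply, hX, Matrix.map_apply, ← h]
    exact Finset.sum_congr rfl fun b _ => (Algebra.commutes _ _).symm
  calc star v * v = v.conjTranspose * (X.conjTranspose * X) * v := by
        rw [hXX, mul_one]; rfl
    _ = (X * v).conjTranspose * (X * v) := by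
        rw [Matrix.conjTranspose_mul]; simp only [Matrix.mul_assoc]
    _ = X.conjTranspose * (w.conjTranspose * w) * X := by
        rw [← hwX, Matrix.conjTranspose_mul]; simp only [Matrix.mul_assoc]
    _ = 1 := by
        have : w.conjTranspose * w = 1 := (Unitary.mem_iff.1 hu).1
        rw [this, Matrix.mul_one, hXX]

/-- The span of the matrix coefficients of irreducible unitary corepresentations that
satisfy a given condition. -/
def irredSpan (p : ∀ n : ℕ, Matrix (Fin n) (Fin n) H → Prop) : Submodule ℂ H :=
  Submodule.span ℂ {a : H | ∃ (n : ℕ) (w : Matrix (Fin n) (Fin n) H), p n w ∧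
    IsIrreducibleCorep w ∧ w ∈ unitary (Matrix (Fin n) (Fin n) H) ∧ ∃ i j, a = w i j}

/-- Invariance of a subspace of `ℂⁿ` under a corepresentation. -/
def IsInvariant {n : ℕ} (w : Matrix (Fin n) (Fin n) H)
    (W : Submodule ℂ (EuclideanSpace ℂ (Fin n))) : Prop :=
  ∀ f : H →ₗ[ℂ] ℂ, ∀ x ∈ W, Matrix.toEuclideanLin (w.map f) x ∈ W

/-- The functional `a ↦ conj (f (S(a)*))`. -/
noncomputable def starAntipodeDual (f : H →ₗ[ℂ] ℂ) : H →ₗ[ℂ] ℂ where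
  toFun a := star (f (star (HopfAlgebra.antipode ℂ a)))
  map_add' a b := by simp
  map_smul' c a := by simp

/-- Unitarity gives `S(w i j) = (w j i)*`, so each `f(w)` is the adjoint of `g(w)` with `g =
starAntipodeDual f`; adjoints of maps preserving `W` preserve `Wᗮ`. -/
lemma IsInvariant.orthogonal {n : ℕ} {w : Matrix (Fin n) (Fin n) H} (hw : IsCorep w)
    (hu : w ∈ unitary (Matrix (Fin n) (Fin n) H))
    {W : Submodule ℂ (EuclideanSpace ℂ (Fin n))} (hW : IsInvariant w W) :
    IsInvariant w Wᗮ := by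
  intro f x hx
  have h : w.map f = (w.map (starAntipodeDual f)).conjTranspose := by
    ext i j
    simp [starAntipodeDual, hw.antipode_apply hu]
  rw [h, Matrix.toEuclideanLin_conjTranspose_eq_adjoint, Submodule.mem_orthogonal]
  intro y hy
  rw [LinearMap.adjoint_inner_right]
  exact (Submodule.mem_orthogonal _ _).1 hx _ (hW _ y hy)

/-- An orthonormal basis of `W` forms the columns of an isometry `M`. Invariance gives `w M = M v`
for `v = M* w M`, and minimality of `W` makes `v` irreducible. -/
lemma sum_smul_mem_irredSpan_of_minimal {n : ℕ} {w : Matrix (Fin n) (Fin n) H}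
    (hw : IsCorep w) (hu : w ∈ unitary (Matrix (Fin n) (Fin n) H))
    {W : Submodule ℂ (EuclideanSpace ℂ (Fin n))} (hW : IsInvariant w W) (hW0 : W ≠ ⊥)
    (hmin : ∀ W', IsInvariant w W' → W' ≤ W → W' = ⊥ ∨ W' = W)
    {x : EuclideanSpace ℂ (Fin n)} (hx : x ∈ W) (a : Fin n) :
    ∑ b, x b • w a b ∈ irredSpan (H := H) fun _ _ => True := by
  let e := stdOrthonormalBasis ℂ W
  let M : Matrix (Fin n) (Fin (Module.finrank ℂ W)) ℂ :=
    Matrix.of fun a j => (e j : EuclideanSpace ℂ (Fin n)) a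
  -- `M M*` fixes every vector of `W`.
  have hexp : ∀ y ∈ W, ∀ a, y a = ∑ l, M a l * ∑ c, star (M c l) * y c := by
    intro y hy a
    have h := congrArg (fun z : W => (z : EuclideanSpace ℂ (Fin n)) a) (e.sum_repr' ⟨y, hy⟩)
    simp only [Submodule.coe_inner, AddSubmonoidClass.coe_finsetSum, Submodule.coe_smul,
      WithLp.ofLp_sum, Finset.sum_apply, WithLp.ofLp_smul, Pi.smul_apply, smul_eq_mul,
      PiLp.inner_apply, RCLike.inner_apply] at h
    rw [← h]
    refine Finset.sum_congr rfl fun l _ => ?_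
    rw [mul_comm]
    congr 1
    exact Finset.sum_congr rfl fun c _ => mul_comm _ _
  have hM : M.conjTranspose * M = 1 := by
    ext i j
    have h := orthonormal_iff_ite.1 e.orthonormal i j
    rw [Submodule.coe_inner, PiLp.inner_apply] at h
    rw [Matrix.mul_apply, Matrix.one_apply, ← h]
    exact Finset.sum_congr rfl fun c _ => mul_comm _ _
  let v : Matrix (Fin (Module.finrank ℂ W)) (Fin (Module.finrank ℂ W)) H :=
    Matrix.of fun i j => ∑ c, star (M c i) • ∑ b, M b j • w c b
  have hv : ∀ a j, ∑ b, M b j • w a b = ∑ l, M a l • v l j := by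
    intro a j
    rw [← sub_eq_zero, ← Module.forall_dual_apply_eq_zero_iff ℂ]
    intro f
    have h := hexp _ (hW f (e j) (e j).2) a
    simp only [Matrix.toLpLin_apply, Matrix.mulVec, dotProduct, Matrix.map_apply] at h
    simp only [map_sub, map_sum, map_smul, v, Matrix.of_apply, smul_eq_mul, sub_eq_zero]
    simp only [M, Matrix.of_apply] at h ⊢
    simpa only [mul_comm] using h
  have hvirr : IsIrreducibleCorep v := by
    refine ⟨hw.compress hM hv, ?_, ?_⟩
    · rwa [Ne, Submodule.finrank_eq_zero]
    · intro W₀ hW₀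
      -- `T` is `M` as an injection onto `W`; it carries `v`-invariant subspaces to `w`-invariant
      -- subspaces of `W`.
      let T : (Fin (Module.finrank ℂ W) → ℂ) →ₗ[ℂ] EuclideanSpace ℂ (Fin n) :=
        (WithLp.linearEquiv 2 ℂ (Fin n → ℂ)).symm.toLinearMap ∘ₗ M.mulVecLin
      have hTe : ∀ ξ, T ξ = ∑ l, ξ l • (e l : EuclideanSpace ℂ (Fin n)) := by
        intro ξ
        ext a
        simp [T, Matrix.mulVec, dotProduct, M, mul_comm]
      have hinj : Function.Injective T := by
        intro ξ η h
        have h1 : M.mulVec ξ = M.mulVec η :=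
          (WithLp.linearEquiv 2 ℂ (Fin n → ℂ)).symm.injective h
        have h2 := congrArg M.conjTranspose.mulVec h1
        simpa [Matrix.mulVec_mulVec, hM] using h2
      have hinv : IsInvariant w (W₀.map T) := by
        rintro f _ ⟨ξ, hξ, rfl⟩
        refine ⟨(v.map f).mulVec ξ, hW₀ f ξ hξ, ?_⟩
        have hfm : w.map f * M = M * v.map f := by
          ext a j
          have := congrArg f (hv a j)
          simpa [Matrix.mul_apply, mul_comm] using this
        have : M.mulVec ((v.map f).mulVec ξ) = (w.map f).mulVec (M.mulVec ξ) := by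
          rw [Matrix.mulVec_mulVec, Matrix.mulVec_mulVec, hfm]
        ext a
        exact congrFun this a
      have hle : W₀.map T ≤ W := by
        rintro _ ⟨ξ, -, rfl⟩
        rw [hTe]
        exact Submodule.sum_mem _ fun l _ => W.smul_mem _ (e l).2
      rcases hmin _ hinv hle with h | h
      · left
        exact Submodule.map_injective_of_injective hinj (by rw [h, Submodule.map_bot])
      · right
        rw [eq_top_iff]
        intro ξ _
        have : T ξ ∈ W₀.map T := by
          rw [h, hTe]
          exact Submodule.sum_mem _ fun l _ => W.smul_mem _ (e l).2
        obtain ⟨η, hη, hηξ⟩ := this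
        rwa [← hinj hηξ]
  have hrew : ∑ b, x b • w a b =
      ∑ l, (∑ c, star (M c l) * x c) • ∑ j, M a j • v j l := by
    simp only [← hv a, Finset.smul_sum]
    rw [Finset.sum_comm]
    refine Finset.sum_congr rfl fun b _ => ?_
    rw [hexp x hx b, Finset.sum_smul]
    exact Finset.sum_congr rfl fun l _ => by rw [smul_smul, mul_comm]
  rw [hrew]
  refine Submodule.sum_mem _ fun l _ => Submodule.smul_mem _ _ <|
    Submodule.sum_mem _ fun j _ => Submodule.smul_mem _ _ <| Submodule.subset_span ?_
  exact ⟨_, v, trivial, hvirr, hw.compress_mem_unitary hu hM hv, j, l, rfl⟩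

/-- Induction on a dimension bound: a nonminimal `W` splits as `W' ⊕ (W'ᗮ ⊓ W)`, two invariant
pieces of smaller dimension. -/
lemma sum_smul_mem_irredSpan {n : ℕ} {w : Matrix (Fin n) (Fin n) H}
    (hw : IsCorep w) (hu : w ∈ unitary (Matrix (Fin n) (Fin n) H)) (d : ℕ)
    {W : Submodule ℂ (EuclideanSpace ℂ (Fin n))} (hW : IsInvariant w W)
    (hd : Module.finrank ℂ W ≤ d)
    {x : EuclideanSpace ℂ (Fin n)} (hx : x ∈ W) (a : Fin n) :
    ∑ b, x b • w a b ∈ irredSpan (H := H) fun _ _ => True := by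
  induction d generalizing W x with
  | zero =>
    rw [Nat.le_zero, Submodule.finrank_eq_zero] at hd
    rw [hd, Submodule.mem_bot] at hx
    simp [hx]
  | succ d ih =>
    by_cases hW0 : W = ⊥
    · rw [hW0, Submodule.mem_bot] at hx
      simp [hx]
    by_cases hmin : ∀ W', IsInvariant w W' → W' ≤ W → W' = ⊥ ∨ W' = W
    · exact sum_smul_mem_irredSpan_of_minimal hw hu hW hW0 hmin hx a
    push Not at hmin
    obtain ⟨W', hW', hle, hbot, hne⟩ := hmin
    obtain ⟨y, hy, z, hz, rfl⟩ := W'.exists_add_mem_mem_orthogonal x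
    have hzW : z ∈ W := by simpa using W.sub_mem hx (hle hy)
    have hlt : W'ᗮ ⊓ W < W := by
      refine lt_of_le_of_ne inf_le_right fun h => hbot ?_
      have : W' ≤ W'ᗮ := hle.trans (inf_eq_right.1 h)
      rw [eq_bot_iff, ← W'.inf_orthogonal_eq_bot]
      exact le_inf le_rfl this
    have h1 := ih hW' (Nat.lt_succ_iff.1
      ((Submodule.finrank_lt_finrank_of_lt (lt_of_le_of_ne hle hne)).trans_le hd)) hy
    have h2 := ih (W := W'ᗮ ⊓ W)
      (fun f t ht => ⟨hW'.orthogonal hw hu f t ht.1, hW f t ht.2⟩)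
      (Nat.lt_succ_iff.1 ((Submodule.finrank_lt_finrank_of_lt hlt).trans_le hd)) ⟨hz, hzW⟩
    simpa [add_smul, Finset.sum_add_distrib] using add_mem h1 h2

lemma IsCorep.apply_mem_irredSpan {n : ℕ} {w : Matrix (Fin n) (Fin n) H}
    (hw : IsCorep w) (hu : w ∈ unitary (Matrix (Fin n) (Fin n) H)) (i j : Fin n) :
    w i j ∈ irredSpan (H := H) fun _ _ => True := by
  have h := sum_smul_mem_irredSpan hw hu _ (W := ⊤) (fun _ _ _ => Submodule.mem_top) le_rfl
    (x := EuclideanSpace.single j 1) Submodule.mem_top i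
  simpa [Pi.single_apply, ite_smul] using h

end Irreducible

/-! ### Spanning by coefficients and the Haar state on the Hopf algebra -/

lemma CompactQuantumGroup.isSpannedByCoeffs (G : CompactQuantumGroup.{u}) :
    IsSpannedByCoeffs G.Pol := by
  rw [IsSpannedByCoeffs, eq_top_iff, ← G.span_coeff]
  exact Submodule.span_mono fun a ⟨n, w, hw, _, h⟩ => ⟨n, w, hw, h⟩

lemma CompactQuantumGroup.irredSpan_eq_top (G : CompactQuantumGroup.{u}) :
    irredSpan (H := G.Pol) (fun _ _ => True) = ⊤ := by
  rw [eq_top_iff, ← G.span_coeff, Submodule.span_le]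
  rintro _ ⟨n, w, hw, hu, i, j, rfl⟩
  exact hw.apply_mem_irredSpan hu i j

/-- The restriction of a functional on `A_N` to `𝒜_N`. -/
noncomputable def restrictPol {N : CompactQuantumGroup.{u}} (h : N.C →L[ℂ] ℂ) :
    N.Pol →ₗ[ℂ] ℂ :=
  h.toLinearMap ∘ₗ N.ι.toAlgHom.toLinearMap

namespace IsHaarState

variable {N : CompactQuantumGroup.{u}} {h : N.C →L[ℂ] ℂ}

lemma restrictPol_one (hh : IsHaarState N h) : restrictPol h 1 = 1 := by
  have : N.ι.toAlgHom.toLinearMap 1 = 1 := _root_.map_one N.ι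
  rw [restrictPol, LinearMap.comp_apply, this]
  exact hh.map_one

lemma rightSlice (hh : IsHaarState N h) (a : N.Pol) :
    rightSlice (restrictPol h) a = restrictPol h a • (1 : N.Pol) :=
  hh.left_invariant a

lemma leftSlice (hh : IsHaarState N h) (a : N.Pol) :
    leftSlice (restrictPol h) a = restrictPol h a • (1 : N.Pol) :=
  hh.right_invariant a

lemma faithful (hh : IsHaarState N h) {x : N.Pol} (hx : ∀ y, restrictPol h (y * x) = 0) :
    x = 0 :=
  eq_zero_of_forall_apply_mul_eq_zero N.isSpannedByCoeffs
    (by rw [hh.restrictPol_one]; exact one_ne_zero) hh.rightSlice hx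

end IsHaarState

/-! ### Quantum subgroups: surjectivity, kernel and exactness -/

namespace QuantumSubgroup

variable {G : CompactQuantumGroup.{u}} {N : CompactQuantumGroup.{v}} (P : QuantumSubgroup G N)

lemma hat_star (a : G.Pol) : P.hat (star a) = star (P.hat a) := by
  apply N.ι_injective
  rw [P.ι_hat, map_star, map_star, map_star, P.ι_hat]

lemma denseRange_ι_hat : DenseRange fun a => N.ι (P.hat a) := by
  simp only [P.ι_hat]
  exact P.surjective.denseRange.comp G.ι_denseRange
    (AddMonoidHomClass.continuous_of_bound P.π 1 fun x => by
      simpa using NonUnitalStarAlgHom.norm_apply_le P.π x)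

lemma isCorep_map {n : ℕ} {w : Matrix (Fin n) (Fin n) G.Pol} (hw : IsCorep w) :
    IsCorep (w.map P.hat) where
  comul_apply i j := by
    rw [Matrix.map_apply, ← CoalgHomClass.map_comp_comul_apply, hw.comul_apply]
    simp
  counit_apply i j := by
    rw [Matrix.map_apply, CoalgHomClass.counit_comp_apply, hw.counit_apply]

lemma star_map_mul {n : ℕ} {w : Matrix (Fin n) (Fin n) G.Pol}
    (hu : w ∈ unitary (Matrix (Fin n) (Fin n) G.Pol)) :
    star (w.map P.hat) * w.map P.hat = 1 := by
  have h1 : star (w.map P.hat) = (star w).map P.hat := by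
    ext i j
    exact (P.hat_star _).symm
  rw [h1, ← Matrix.map_mul, (Unitary.mem_iff.1 hu).1]
  simp

variable {P} {h : N.C →L[ℂ] ℂ}

/-- For a unitary coefficient `y`, the antipode identity and invariance of `h` give a combination of
antipodes of entries of `π̂(w)`, which are the images `π̂((w m i)*)`. -/
lemma rightSlice_restrictPol_mem_range (hh : IsHaarState N h) (y : G.Pol) (x : N.Pol) :
    rightSlice (restrictPol h ∘ₗ LinearMap.mulLeft ℂ (P.hat y)) x ∈
      LinearMap.range (P.hat : G.Pol →ₗ[ℂ] N.Pol) := by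
  suffices ⊤ ≤ (LinearMap.range (P.hat : G.Pol →ₗ[ℂ] N.Pol)).comap
      (rightSliceMul (restrictPol h) x ∘ₗ (P.hat : G.Pol →ₗ[ℂ] N.Pol)) from
    this (Submodule.mem_top (x := y))
  rw [← G.span_coeff, Submodule.span_le]
  rintro _ ⟨n, w, hw, hu, i, j, rfl⟩
  change rightSlice (restrictPol h ∘ₗ LinearMap.mulLeft ℂ (w.map P.hat i j)) x ∈
    LinearMap.range (P.hat : G.Pol →ₗ[ℂ] N.Pol)
  rw [← (P.isCorep_map hw).sum_antipode_mul_rightSlice]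
  refine Submodule.sum_mem _ fun m _ => ?_
  rw [hh.rightSlice, mul_smul_comm, mul_one, (P.isCorep_map hw).antipode_apply
    ((P.isCorep_map hw).mem_unitary (P.star_map_mul hu))]
  exact Submodule.smul_mem _ _ ⟨star (w m i), P.hat_star _⟩

/-- A functional `f` killing the range makes `(f ⊗ id)Δ(x)` orthogonal to the range under `h`; the
range is dense in `A_N`, so this slice is zero by nondegeneracy. -/
lemma hat_surjective (hh : IsHaarState N h) : Function.Surjective P.hat := by
  intro x
  change x ∈ LinearMap.range (P.hat : G.Pol →ₗ[ℂ] N.Pol)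
  refine mem_of_forall_leftSlice fun f hf => ?_
  rw [hh.faithful (x := leftSlice f x), map_zero]
  have h1 : ∀ y, restrictPol h (P.hat y * leftSlice f x) = 0 := fun y => by
    have h2 := apply_rightSlice f (restrictPol h ∘ₗ LinearMap.mulLeft ℂ (P.hat y)) x
    rw [hf (rightSlice_restrictPol_mem_range hh y x)] at h2
    exact h2.symm
  -- Continuity of `h` extends the vanishing from the dense image of `π̂` to all of `A_N`.
  have h3 : (fun c : N.C => h (c * N.ι (leftSlice f x))) = fun _ => 0 := by
    refine P.denseRange_ι_hat.equalizer (by fun_prop) (by fun_prop) (funext fun y => ?_)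
    have := h1 y
    rw [restrictPol, LinearMap.comp_apply] at this
    change h (N.ι _) = 0 at this
    rwa [map_mul] at this
  intro y
  have := congrFun h3 (N.ι y)
  simp only [← map_mul] at this
  exact this

lemma mem_quotient_iff {a : G.Pol} : a ∈ P.quotient ↔
    LinearMap.lTensor G.Pol (P.hat : G.Pol →ₗ[ℂ] N.Pol) (Coalgebra.comul (R := ℂ) a) =
      a ⊗ₜ[ℂ] 1 := Iff.rfl

lemma hat_eq_of_mem_quotient {a : G.Pol} (ha : a ∈ P.quotient) :
    P.hat a = Coalgebra.counit (R := ℂ) a • (1 : N.Pol) := by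
  have h1 := congrArg (fun t => TensorProduct.lid ℂ N.Pol
    (LinearMap.rTensor N.Pol (Coalgebra.counit (R := ℂ)) t)) (mem_quotient_iff.1 ha)
  simp only [LinearMap.rTensor_tmul, TensorProduct.lid_tmul] at h1
  rw [← h1, ← LinearMap.comp_apply (LinearMap.rTensor _ _), LinearMap.rTensor_comp_lTensor,
    ← LinearMap.lTensor_comp_rTensor, LinearMap.comp_apply, Coalgebra.rTensor_counit_comul]
  simp

lemma star_mem_quotient {a : G.Pol} (ha : a ∈ P.quotient) : star a ∈ P.quotient := by
  have key : ∀ t : G.Pol ⊗[ℂ] G.Pol,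
      LinearMap.lTensor G.Pol (P.hat : G.Pol →ₗ[ℂ] N.Pol) (star t) =
        star (LinearMap.lTensor G.Pol (P.hat : G.Pol →ₗ[ℂ] N.Pol) t) := by
    intro t
    induction t using TensorProduct.induction_on with
    | zero => simp
    | tmul a b => simp [P.hat_star]
    | add a b ha hb => simp only [star_add, map_add, ha, hb]
  rw [mem_quotient_iff] at ha ⊢
  rw [G.comul_star, key, ha, TensorProduct.star_tmul, star_one]

/-- On `𝒜_{G/N}` the map `π̂` is `ε(·) 1`, and `1 ≠ 0` in `𝒜_N` because `h 1 = 1`. -/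
lemma augmentation_quotient (hh : IsHaarState N h) : augmentation P.quotient =
    Subalgebra.toSubmodule P.quotient ⊓ LinearMap.ker (P.hat : G.Pol →ₗ[ℂ] N.Pol) := by
  have h1 : (1 : N.Pol) ≠ 0 := fun h0 => by
    have := hh.restrictPol_one
    rw [h0, map_zero] at this
    exact zero_ne_one this
  ext a
  refine and_congr_right fun ha => ?_
  have h2 : (P.hat : G.Pol →ₗ[ℂ] N.Pol) a = Coalgebra.counit (R := ℂ) a • (1 : N.Pol) :=
    hat_eq_of_mem_quotient ha
  change Coalgebra.counit (R := ℂ) a = 0 ↔ (P.hat : G.Pol →ₗ[ℂ] N.Pol) a = 0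
  rw [h2, smul_eq_zero, or_iff_left h1]

/-- The composition of the Haar state of `N` with `𝒜_G → 𝒜_N`. -/
noncomputable def haarHat (P : QuantumSubgroup G N) (h : N.C →L[ℂ] ℂ) : G.Pol →ₗ[ℂ] ℂ :=
  restrictPol h ∘ₗ (P.hat : G.Pol →ₗ[ℂ] N.Pol)

lemma haarHat_apply (a : G.Pol) : P.haarHat h a = restrictPol h (P.hat a) := rfl

/-- By coassociativity `(id ⊗ π̂)Δ` of the slice is `a₁ ⊗ (id ⊗ h)Δ(π̂ a₂)`, and invariance turns
the second leg into `φ(a₂) 1`. The computation is done on coefficients. -/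
lemma rightSlice_haarHat_mem_quotient (hh : IsHaarState N h) (a : G.Pol) :
    rightSlice (P.haarHat h) a ∈ P.quotient := by
  suffices ⊤ ≤ (Subalgebra.toSubmodule P.quotient).comap (rightSlice (P.haarHat h)) from
    this Submodule.mem_top
  rw [← G.isSpannedByCoeffs, Submodule.span_le]
  rintro _ ⟨n, w, hw, i, j, rfl⟩
  change rightSlice (P.haarHat h) (w i j) ∈ P.quotient
  have h1 := fun m => (hh.rightSlice (P.hat (w m j))).symm.trans
    ((P.isCorep_map hw).rightSlice_apply (restrictPol h) m j)
  simp only [Matrix.map_apply] at h1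
  rw [mem_quotient_iff, hw.rightSlice_apply]
  simp only [map_sum, map_smul, hw.comul_apply, LinearMap.lTensor_tmul, Finset.smul_sum,
    TensorProduct.sum_tmul]
  rw [Finset.sum_comm]
  refine Finset.sum_congr rfl fun m _ => ?_
  simp only [← TensorProduct.tmul_smul, ← TensorProduct.tmul_sum, ← TensorProduct.smul_tmul']
  rw [haarHat_apply, h1]
  rfl

lemma hat_rightSlice_haarHat (hh : IsHaarState N h) (a : G.Pol) :
    P.hat (rightSlice (P.haarHat h) a) = P.haarHat h a • (1 : N.Pol) := by
  have h1 : Coalgebra.counit (R := ℂ) (rightSlice (P.haarHat h) a) = P.haarHat h a := by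
    have := apply_rightSlice (Coalgebra.counit (R := ℂ)) (P.haarHat h) a
    rw [this, leftSlice_apply, Coalgebra.rTensor_counit_comul]
    simp
  rw [hat_eq_of_mem_quotient (rightSlice_haarHat_mem_quotient hh a), h1]

lemma rightSlice_haarHat_of_mem (hh : IsHaarState N h) {a : G.Pol} (ha : a ∈ P.quotient) :
    rightSlice (P.haarHat h) a = a := by
  rw [rightSlice_apply, haarHat, LinearMap.lTensor_comp, LinearMap.comp_apply,
    mem_quotient_iff.1 ha]
  simp [hh.restrictPol_one]

lemma leftSlice_haarHat_of_coinvariant (hh : IsHaarState N h) {a : G.Pol}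
    (ha : TensorProduct.map (P.hat : G.Pol →ₗ[ℂ] N.Pol) LinearMap.id
      (Coalgebra.comul (R := ℂ) a) = (1 : N.Pol) ⊗ₜ[ℂ] a) :
    leftSlice (P.haarHat h) a = a := by
  rw [leftSlice_apply, haarHat, LinearMap.rTensor_comp, LinearMap.comp_apply]
  rw [← LinearMap.rTensor_def] at ha
  rw [ha]
  simp [hh.restrictPol_one]

lemma coinvariant_leftSlice_haarHat (hh : IsHaarState N h) (a : G.Pol) :
    TensorProduct.map (P.hat : G.Pol →ₗ[ℂ] N.Pol) LinearMap.id
      (Coalgebra.comul (R := ℂ) (leftSlice (P.haarHat h) a)) =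
        (1 : N.Pol) ⊗ₜ[ℂ] leftSlice (P.haarHat h) a := by
  suffices ⊤ ≤ LinearMap.eqLocus
      (TensorProduct.map (P.hat : G.Pol →ₗ[ℂ] N.Pol) LinearMap.id ∘ₗ
        Coalgebra.comul (R := ℂ) ∘ₗ leftSlice (P.haarHat h))
      (TensorProduct.mk ℂ N.Pol G.Pol 1 ∘ₗ leftSlice (P.haarHat h)) from
    this (x := a) Submodule.mem_top
  rw [← G.isSpannedByCoeffs, Submodule.span_le]
  rintro _ ⟨n, w, hw, i, j, rfl⟩
  have h1 := fun m => (hh.leftSlice (P.hat (w i m))).symm.trans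
    ((P.isCorep_map hw).leftSlice_apply (restrictPol h) i m)
  simp only [Matrix.map_apply] at h1
  change TensorProduct.map _ _ (Coalgebra.comul (leftSlice (P.haarHat h) (w i j))) =
    1 ⊗ₜ[ℂ] leftSlice (P.haarHat h) (w i j)
  rw [hw.leftSlice_apply]
  simp only [map_sum, map_smul, hw.comul_apply, TensorProduct.map_tmul, Finset.smul_sum,
    TensorProduct.tmul_sum]
  rw [Finset.sum_comm]
  refine Finset.sum_congr rfl fun m _ => ?_
  simp only [TensorProduct.smul_tmul', ← TensorProduct.sum_tmul, TensorProduct.tmul_smul]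
  rw [haarHat_apply, h1]
  rfl

/-- The kernel of `π̂` is generated as a left ideal by the augmentation ideal of `𝒜_{G/N}`;
normality is not needed. -/
lemma ker_hat_le (hh : IsHaarState N h) :
    LinearMap.ker (P.hat : G.Pol →ₗ[ℂ] N.Pol) ≤ ⊤ * augmentation P.quotient := by
  intro x hx
  have hx0 : P.hat x = 0 := hx
  refine mem_of_forall_leftSlice fun f hf => ?_
  rw [← CoalgHomClass.counit_comp_apply P.hat, hh.faithful (x := P.hat (leftSlice f x)), map_zero]
  intro y
  obtain ⟨y, rfl⟩ := hat_surjective (P := P) hh y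
  rw [← map_mul, ← haarHat_apply]
  have h1 : rightSlice (P.haarHat h ∘ₗ LinearMap.mulLeft ℂ y) x ∈
      (⊤ : Submodule ℂ G.Pol) * augmentation P.quotient := by
    refine rightSlice_comp_mulLeft_mem G.isSpannedByCoeffs (fun a b => ?_) y
    refine Submodule.mul_mem_mul Submodule.mem_top ?_
    rw [augmentation_quotient hh]
    refine ⟨rightSlice_haarHat_mem_quotient hh _, ?_⟩
    change P.hat _ = 0
    rw [hat_rightSlice_haarHat hh, haarHat_apply, map_mul, hx0, mul_zero, map_zero, zero_smul]
  have h2 := apply_rightSlice f (P.haarHat h ∘ₗ LinearMap.mulLeft ℂ y) x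
  rw [hf h1] at h2
  exact h2.symm

lemma ker_hat_eq_mul (hh : IsHaarState N h) :
    LinearMap.ker (P.hat : G.Pol →ₗ[ℂ] N.Pol) = ⊤ * augmentation P.quotient := by
  refine le_antisymm (ker_hat_le hh) (Submodule.mul_le.2 fun a _ b hb => ?_)
  rw [augmentation_quotient hh] at hb
  have hb' : P.hat b = 0 := hb.2
  change P.hat (a * b) = 0
  rw [map_mul, hb', mul_zero]

lemma ker_hat_eq_mul' (hh : IsHaarState N h) :
    LinearMap.ker (P.hat : G.Pol →ₗ[ℂ] N.Pol) = augmentation P.quotient * ⊤ := by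
  refine le_antisymm (fun x hx => ?_) (Submodule.mul_le.2 fun b hb a _ => ?_)
  · have hx0 : P.hat x = 0 := hx
    have hsx : star x ∈ LinearMap.ker (P.hat : G.Pol →ₗ[ℂ] N.Pol) := by
      change P.hat _ = 0
      rw [P.hat_star, hx0, star_zero]
    suffices ∀ z ∈ (⊤ : Submodule ℂ G.Pol) * augmentation P.quotient,
        star z ∈ augmentation P.quotient * ⊤ by
      simpa using this _ (ker_hat_le hh hsx)
    intro z hz
    induction hz using Submodule.mul_induction_on' with
    | mem_mul_mem a _ b hb =>
      rw [star_mul]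
      refine Submodule.mul_mem_mul ?_ Submodule.mem_top
      rw [augmentation_quotient hh] at hb ⊢
      have hb' : P.hat b = 0 := hb.2
      refine ⟨star_mem_quotient hb.1, ?_⟩
      change P.hat _ = 0
      rw [P.hat_star, hb', star_zero]
    | add a _ b _ ha hb => rw [star_add]; exact add_mem ha hb
  · rw [augmentation_quotient hh] at hb
    have hb' : P.hat b = 0 := hb.2
    change P.hat (b * a) = 0
    rw [map_mul, hb', zero_mul]

lemma ker_hat_eq_mul_mul (hh : IsHaarState N h) :
    LinearMap.ker (P.hat : G.Pol →ₗ[ℂ] N.Pol) = ⊤ * augmentation P.quotient * ⊤ := by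
  rw [← ker_hat_eq_mul hh]
  refine le_antisymm (fun x hx => ?_) (Submodule.mul_le.2 fun b hb a _ => ?_)
  · simpa using Submodule.mul_mem_mul hx (Submodule.mem_top (x := (1 : G.Pol)))
  · have hb' : P.hat b = 0 := hb
    change P.hat (b * a) = 0
    rw [map_mul, hb', zero_mul]

/-- On an irreducible `w` the two slices are `w φ(w)` and `φ(w) w`, which agree when `φ(w)` is `1`
or `0`. -/
lemma rightSlice_haarHat_eq_leftSlice
    (hN : ∀ (n : ℕ) (w : Matrix (Fin n) (Fin n) G.Pol), IsIrreducibleCorep w →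
      w ∈ unitary (Matrix (Fin n) (Fin n) G.Pol) →
        w.map (P.haarHat h) = 1 ∨ w.map (P.haarHat h) = 0) :
    rightSlice (P.haarHat h) = leftSlice (P.haarHat h) := by
  refine LinearMap.ext_on G.irredSpan_eq_top ?_
  rintro _ ⟨n, w, -, hw, hu, i, j, rfl⟩
  rw [hw.rightSlice_apply, hw.leftSlice_apply]
  rcases hN n w hw hu with h1 | h1
  · have h2 : ∀ i j, P.haarHat h (w i j) = if i = j then 1 else 0 := fun i j =>
      congrFun (congrFun h1 i) j
    simp [h2]
  · have h2 : ∀ i j, P.haarHat h (w i j) = 0 := fun i j => congrFun (congrFun h1 i) j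
    simp [h2]

/-- The slice `E` fixes `𝒜_{G/N}` and kills the coefficients of irreducibles with `φ(w) = 0`, so
only those with `φ(w) = 1` contribute. -/
lemma toSubmodule_quotient_le (hh : IsHaarState N h)
    (hN : ∀ (n : ℕ) (w : Matrix (Fin n) (Fin n) G.Pol), IsIrreducibleCorep w →
      w ∈ unitary (Matrix (Fin n) (Fin n) G.Pol) →
        w.map (P.haarHat h) = 1 ∨ w.map (P.haarHat h) = 0) :
    Subalgebra.toSubmodule P.quotient ≤ irredSpan fun _ w => w.map (P.haarHat h) = 1 := by
  suffices ⊤ ≤ (irredSpan fun _ w => w.map (P.haarHat h) = 1).comap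
      (rightSlice (P.haarHat h)) by
    intro a ha
    rw [← rightSlice_haarHat_of_mem hh ha]
    exact this Submodule.mem_top
  rw [← G.irredSpan_eq_top]
  refine Submodule.span_le.2 ?_
  rintro _ ⟨n, w, -, hw, hu, i, j, rfl⟩
  change rightSlice (P.haarHat h) (w i j) ∈ irredSpan _
  rw [hw.rightSlice_apply]
  rcases hN n w hw hu with h1 | h1
  · exact Submodule.sum_mem _ fun k _ => Submodule.smul_mem _ _ <|
      Submodule.subset_span ⟨n, w, h1, hw, hu, i, k, rfl⟩
  · have h2 : ∀ i j, P.haarHat h (w i j) = 0 := fun i j => congrFun (congrFun h1 i) j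
    simp [h2]

lemma coeff_mem_quotient (hh : IsHaarState N h) {n : ℕ} {w : Matrix (Fin n) (Fin n) G.Pol}
    (hw : IsCorep w) (h1 : w.map (P.haarHat h) = 1) (i j : Fin n) : w i j ∈ P.quotient := by
  have h2 : ∀ i j, P.haarHat h (w i j) = if i = j then 1 else 0 := fun i j =>
    congrFun (congrFun h1 i) j
  have h3 := hw.rightSlice_apply (P.haarHat h) i j
  simp only [h2, ite_smul, one_smul, zero_smul, Finset.sum_ite_eq', Finset.mem_univ,
    if_true] at h3
  rw [← h3]
  exact rightSlice_haarHat_mem_quotient hh _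

lemma isExactSequence (hh : IsHaarState N h)
    (hN : ∀ (n : ℕ) (w : Matrix (Fin n) (Fin n) G.Pol), IsIrreducibleCorep w →
      w ∈ unitary (Matrix (Fin n) (Fin n) G.Pol) →
        w.map (P.haarHat h) = 1 ∨ w.map (P.haarHat h) = 0) :
    IsExactSequence P.quotient P.hat where
  comul_mem a ha := by
    suffices irredSpan (fun _ w => w.map (P.haarHat h) = 1) ≤
        (LinearMap.range (TensorProduct.map P.quotient.val.toLinearMap
          P.quotient.val.toLinearMap)).comap (Coalgebra.comul (R := ℂ)) from
      this (toSubmodule_quotient_le hh hN ha)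
    refine Submodule.span_le.2 ?_
    rintro _ ⟨n, w, h1, hw, hu, i, j, rfl⟩
    change Coalgebra.comul (R := ℂ) (w i j) ∈ LinearMap.range _
    rw [hw.comul_apply]
    refine Submodule.sum_mem _ fun k _ => ?_
    exact ⟨⟨w i k, coeff_mem_quotient hh hw.toIsCorep h1 i k⟩ ⊗ₜ[ℂ]
      ⟨w k j, coeff_mem_quotient hh hw.toIsCorep h1 k j⟩, rfl⟩
  antipode_mem a ha := by
    suffices irredSpan (fun _ w => w.map (P.haarHat h) = 1) ≤
        (Subalgebra.toSubmodule P.quotient).comap (HopfAlgebra.antipode ℂ) from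
      this (toSubmodule_quotient_le hh hN ha)
    refine Submodule.span_le.2 ?_
    rintro _ ⟨n, w, h1, hw, hu, i, j, rfl⟩
    change HopfAlgebra.antipode ℂ (w i j) ∈ P.quotient
    rw [hw.toIsCorep.antipode_apply hu]
    exact star_mem_quotient (coeff_mem_quotient hh hw.toIsCorep h1 j i)
  surjective := hat_surjective hh
  ker_eq := ker_hat_eq_mul hh
  mem_iff a := by
    -- The right and left slices project onto the two algebras of coinvariants; being equal, they
    -- have the same image.
    have hE := congrArg (fun F : G.Pol →ₗ[ℂ] G.Pol => F a) (rightSlice_haarHat_eq_leftSlice hN)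
    constructor
    · intro ha
      rw [← rightSlice_haarHat_of_mem hh ha, hE]
      exact coinvariant_leftSlice_haarHat hh a
    · intro ha
      rw [← leftSlice_haarHat_of_coinvariant hh ha, ← hE]
      exact rightSlice_haarHat_mem_quotient hh a

end QuantumSubgroup

end CQG

theorem mainTheorem9 (G : CQG.CompactQuantumGroup.{u}) (N : CQG.CompactQuantumGroup.{v})
    (P : CQG.QuantumSubgroup G N)
    (hP : P.IsNormal) :
    LinearMap.ker (P.hat : G.Pol →ₗ[ℂ] N.Pol) = CQG.augmentation P.quotient * ⊤ ∧
    LinearMap.ker (P.hat : G.Pol →ₗ[ℂ] N.Pol) = ⊤ * CQG.augmentation P.quotient ∧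
    LinearMap.ker (P.hat : G.Pol →ₗ[ℂ] N.Pol) = ⊤ * CQG.augmentation P.quotient * ⊤ ∧
    CQG.IsExactSequence P.quotient P.hat := by
  obtain ⟨h, hh, hN⟩ := hP
  refine ⟨CQG.QuantumSubgroup.ker_hat_eq_mul' hh, CQG.QuantumSubgroup.ker_hat_eq_mul hh,
    CQG.QuantumSubgroup.ker_hat_eq_mul_mul hh, CQG.QuantumSubgroup.isExactSequence hh ?_⟩
  intro n w hw hu
  have h1 : w.map (P.haarHat h) = w.map fun a => h (P.π (G.ι a)) := by
    ext i j
    rw [Matrix.map_apply, Matrix.map_apply, ← P.ι_hat]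
    rfl
  rw [h1]
  exact hN n w hw hu
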